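/- Let $d\in\mathbb N$, let $G\in C^4(\mathbb R^d;\mathbb R^d)$ and $x^\dagger\in\mathbb R^d$ be such that $G(x)=G(x^\dagger)$ implies $x=x^\dagger$, and such that $G$ is a $C^1$-diffeomorphism from a neighbourhood of $x^\dagger$ onto its open image. Let $V_0\in C^2(\mathbb R^d;\mathbb R)$ be non-negative with $\int_{\mathbb R^d}e^{-V_0(x)}\,dx<\infty$. For $\varepsilon>0$ and $\eta\in\mathbb R^d$ put $$V_1^{\varepsilon,\eta}(x)=\tfrac12\,\bigl|G(x^\dagger)-G(x)+\sqrt\varepsilon\,\eta\bigr|^2,\qquad \mu_\varepsilon^\eta(dx)=\frac1{Z_{\mu,\varepsilon}^\eta}\exp\Bigl(-\tfrac1\varepsilon V_1^{\varepsilon,\eta}(x)-V_0(x)\Bigr)\,dx,$$ where $Z_{\mu,\varepsilon}^\eta$ is the normalization constant. Assume that for every $\eta\in\mathbb R^d$ there are constants $\varepsilon_0,C,c_0,c_1>0$ (which may depend on $\eta$) such that for all $0<\varepsilon<\varepsilon_0$ and all $x\in\mathbb R^d$ $$|\partial^\alpha V_1^{\varepsilon,\eta}(x)|\le C e^{|x|^2}\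 \ (|\alpha|\le4),\qquad |\partial^\beta V_0(x)|\le C e^{|x|^2}\ \ (|\beta|\le2),\qquad V_1^{\varepsilon,\eta}(x)\ge -c_0+c_1|x|^2 .$$ Let $\mathcal A$ be the set of all Gaussian measures $N(m,\Sigma)$ on $\mathbb R^d$ with $m\in\mathbb R^d$ and $\Sigma$ a symmetric positive semi-definite matrix, and let $\mathbb P^\eta$ denote the probability under the law $N(0,\mathbf I_d)$ of $\eta$. Let $d_{\mathrm{TV}}(\mu,\nu)=\sup_A|\mu(A)-\nu(A)|$ be the total variation distance. Then for every $\delta>0$ there is a constant $M=M(\delta)>0$ such that, for all sufficiently small $\varepsilon>0$, $$\mathbb P^\eta\bigl(\eta:\ d_{\mathrm{TV}}(\mu_\varepsilon^\eta,\nu_\varepsilon^\eta)\ge M\sqrt\varepsilon\bigr)\le\delta ,$$ where, for each $\eta$, $\nu_\varepsilon^\eta$ is any minimizer of the Kullback–Leibler divergence $\nu\mapsto D_{\mathrm{KL}}(\nu\,\|\,\mu_\varepsilon^\eta)$ over $\mathcal A$. Both $M$ and the threshold for $\varepsilon$ are independent of the choice of the minimizers; if the set in question is not measurable, its probability is understood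 as outer measure. -/

import Mathlib

open MeasureTheory ProbabilityTheory InformationTheory Filter Topology
open scoped Manifold

noncomputable section

namespace BayesInverse

/-- `ℝ^d` with its Euclidean norm. -/
abbrev Vec (d : ℕ) : Type := EuclideanSpace ℝ (Fin d)

/-- The potential `V₁^ε(x) = ½ |G(x†) - G(x) + √ε η|²` of the inverse problem with truth `x†`,
noise level `√ε` and noise `η`. -/
def misfit {d : ℕ} (G : Vec d → Vec d) (xt η : Vec d) (ε : ℝ) (x : Vec d) : ℝ :=
  (1 / 2) * ‖G xt - G x + √ε • η‖ ^ 2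

/-- The posterior distribution
`μ_ε^η(dx) = Z⁻¹ exp(-(1/(2ε)) |G(x†) - G(x) + √ε η|² - V₀(x)) dx`,
where `Z` is the Lebesgue integral of the exponential (`volume.tilted f` is the measure with
Lebesgue density `exp f / ∫ exp f`). -/
def posterior {d : ℕ} (G : Vec d → Vec d) (V₀ : Vec d → ℝ) (xt : Vec d) (ε : ℝ) (η : Vec d) :
    Measure (Vec d) :=
  (volume : Measure (Vec d)).tilted fun x => -(1 / ε) * misfit G xt η ε x - V₀ x

/-- The set `𝒜` of all Gaussian measures `N(m, Σ)` on `ℝ^d`, with `m ∈ ℝ^d` and `Σ` a symmetric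
positive semi-definite matrix. -/
def gaussianMeasures (d : ℕ) : Set (Measure (Vec d)) :=
  {ν | ∃ (m : Vec d) (S : Matrix (Fin d) (Fin d) ℝ), S.PosSemidef ∧ ν = multivariateGaussian m S}

/-- `ν` is a best Gaussian approximation of `μ`: it minimizes `D_KL(· || μ)` over `𝒜`. -/
def IsBestGaussian {d : ℕ} (μ ν : Measure (Vec d)) : Prop :=
  ν ∈ gaussianMeasures d ∧ ∀ ν' ∈ gaussianMeasures d, klDiv ν μ ≤ klDiv ν' μ

/-- The total variation distance `sup_A |μ(A) - ν(A)|`, over all measurable sets `A`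
(the supremum is over a bounded set, since it is used for probability measures). -/
def tvDist {Ω : Type*} [MeasurableSpace Ω] (μ ν : Measure Ω) : ℝ :=
  ⨆ s : {s : Set Ω // MeasurableSet s}, |μ.real s.1 - ν.real s.1|

/-- Growth conditions on a family of potentials `(V₁^ε)_{ε > 0}` and a potential `V₂` on `ℝ^d`:
regularity and non-negativity, a bound of the derivatives by a multiple of `exp |x|²`, and
quadratic coercivity of `V₁^ε`, uniformly in small `ε`. The operator norm of the `k`-th derivative
and the largest modulus of a partial derivative of order `k` bound each other up to constants
depending on `d` and `k` only. -/
structure GrowthConditions {d : ℕ} (V₁ : ℝ → Vec d → ℝ) (V₂ : Vec d → ℝ) : Prop where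
  contDiff_fst : ∀ ε > 0, ContDiff ℝ 4 (V₁ ε)
  contDiff_snd : ContDiff ℝ 2 V₂
  nonneg_fst : ∀ ε > 0, ∀ x, 0 ≤ V₁ ε x
  nonneg_snd : ∀ x, 0 ≤ V₂ x
  derivBound : ∃ ε₀ > 0, ∃ C > 0, ∀ ε, 0 < ε → ε < ε₀ → ∀ x,
    (∀ k ≤ 4, ‖iteratedFDeriv ℝ k (V₁ ε) x‖ ≤ C * Real.exp (‖x‖ ^ 2)) ∧
    (∀ k ≤ 2, ‖iteratedFDeriv ℝ k V₂ x‖ ≤ C * Real.exp (‖x‖ ^ 2))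
  coercive : ∃ ε₀ > 0, ∃ c₀ > 0, ∃ c₁ > 0, ∀ ε, 0 < ε → ε < ε₀ → ∀ x,
    -c₀ + c₁ * ‖x‖ ^ 2 ≤ V₁ ε x

end BayesInverse

end

/-! The minimizer `ν η` is never described: its divergence from the posterior is at most that of any
Gaussian competitor, so a single competitor with divergence O(ε) suffices, and a Pinsker-type
inequality turns O(ε) into total variation O(√ε). Tightness of the noise law reduces everything to
‖η‖ ≤ R, where all constants must be uniform.

The competitor is the law of `xt + √ε A⁻¹(η + w)`, with `A` the derivative of `G` at `xt` and `w`
standard Gaussian. In the variable `w` it becomes the standard Gaussian γ, and the posterior becomes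
the tilt of γ by F = `logRatio` (`posterior_eq_map`). The divergence is then log ∫ exp F dγ − ∫ F
dγ, which is at most ∫ F² (1 + exp F) dγ (`klDiv_tilted_right_le`).

Two estimates make this integral O(ε). Taylor expansion at `xt` gives |F| ≤ C √ε exp(θ‖w‖²) with θ
as small as desired (`abs_logRatio_le`). A global linear lower bound on ‖G x − G xt‖ gives F ≤ (1/2
− κ)‖w‖² + C, hence integrability of exp F (`logRatio_le`). -/

namespace BayesInverse

/-! ### Total variation and Kullback–Leibler divergence -/

/-- Pointwise form of "squared Hellinger distance ≤ divergence". With s = √x, it is log s ≥ 1 − 1/s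
multiplied by 2s². -/
lemma sq_sqrt_sub_one_le_klFun {x : ℝ} (hx : 0 ≤ x) : (√x - 1) ^ 2 ≤ klFun x := by
  rcases hx.eq_or_lt with rfl | hx
  · simp [klFun_zero]
  obtain ⟨s, hs, rfl⟩ : ∃ s : ℝ, 0 < s ∧ s ^ 2 = x := ⟨√x, Real.sqrt_pos.2 hx, Real.sq_sqrt hx.le⟩
  rw [Real.sqrt_sq hs.le, klFun_apply, Real.log_pow]
  have h := mul_le_mul_of_nonneg_left (Real.one_sub_inv_le_log_of_pos hs) (sq_nonneg s)
  have h2 : s ^ 2 * (1 - s⁻¹) = s ^ 2 - s := by field_simp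
  push_cast
  nlinarith

lemma abs_sub_one_le_klFun {x t : ℝ} (hx : 0 ≤ x) (ht : 0 < t) :
    |x - 1| ≤ klFun x / t + t * (x + 1) / 2 := by
  have h := sq_sqrt_sub_one_le_klFun hx
  set s := √x with hs
  have hs0 : 0 ≤ s := Real.sqrt_nonneg x
  have hsx : x = s ^ 2 := (Real.sq_sqrt hx).symm
  have h1 : |x - 1| = |s - 1| * (s + 1) := by
    rw [hsx, show s ^ 2 - 1 = (s - 1) * (s + 1) by ring, abs_mul, abs_of_nonneg (by linarith : 0 ≤ s + 1)]
  have h2 : |s - 1| * (s + 1) ≤ |s - 1| ^ 2 / t + t * (s + 1) ^ 2 / 4 := by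
    have h3 : 0 ≤ (|s - 1| / t - (s + 1) / 2) ^ 2 * t := by positivity
    have h4 : (|s - 1| / t - (s + 1) / 2) ^ 2 * t
        = |s - 1| ^ 2 / t + t * (s + 1) ^ 2 / 4 - |s - 1| * (s + 1) := by
      field_simp; ring
    linarith
  have h5 : |s - 1| ^ 2 / t ≤ klFun x / t := by
    rw [sq_abs]; gcongr
  have h6 : t * (s + 1) ^ 2 / 4 ≤ t * (x + 1) / 2 := by
    rw [hsx]; nlinarith [mul_nonneg ht.le (sq_nonneg (s - 1))]
  linarith

/-- A Pinsker inequality with non-optimal constant: `abs_sub_one_le_klFun` is integrated against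
`μ`, where the density has mean 1, so its second term contributes exactly t. -/
lemma tvDist_le_of_klDiv_le {Ω : Type*} [MeasurableSpace Ω] {μ ν : Measure Ω}
    [IsProbabilityMeasure μ] [IsProbabilityMeasure ν] {K t : ℝ} (ht : 0 < t) (hK : 0 ≤ K)
    (h : klDiv ν μ ≤ ENNReal.ofReal (K * t ^ 2)) : tvDist μ ν ≤ (K + 1) * t := by
  have hne : klDiv ν μ ≠ ⊤ := ne_top_of_le_ne_top ENNReal.ofReal_ne_top h
  obtain ⟨hac, hint⟩ := klDiv_ne_top_iff.1 hne
  have hkl : ∫ x, klFun (ν.rnDeriv μ x).toReal ∂μ ≤ K * t ^ 2 := by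
    rw [← toReal_klDiv_eq_integral_klFun hac]
    exact ENNReal.toReal_le_of_le_ofReal (by positivity) h
  have hi1 : Integrable (fun x => (ν.rnDeriv μ x).toReal) μ := Measure.integrable_toReal_rnDeriv
  have hi2 : Integrable (fun x => klFun (ν.rnDeriv μ x).toReal) μ :=
    (integrable_klFun_rnDeriv_iff hac).2 hint
  have hi3 : Integrable (fun x => (ν.rnDeriv μ x).toReal - 1) μ := hi1.sub (integrable_const _)
  have h1 : ∫ x, (ν.rnDeriv μ x).toReal ∂μ = 1 := by
    rw [Measure.integral_toReal_rnDeriv hac]; simp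
  have hmain : ∫ x, |(ν.rnDeriv μ x).toReal - 1| ∂μ ≤ (K + 1) * t := by
    calc ∫ x, |(ν.rnDeriv μ x).toReal - 1| ∂μ
        ≤ ∫ x, (klFun (ν.rnDeriv μ x).toReal / t + t * ((ν.rnDeriv μ x).toReal + 1) / 2) ∂μ := by
          refine integral_mono hi3.abs ?_ fun x => abs_sub_one_le_klFun ENNReal.toReal_nonneg ht
          exact (hi2.div_const _).add (((hi1.add (integrable_const _)).const_mul _).div_const _)
      _ = (∫ x, klFun (ν.rnDeriv μ x).toReal ∂μ) / t + t := by
          have hi4 : Integrable (fun x => t * ((ν.rnDeriv μ x).toReal + 1) / 2) μ :=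
            ((hi1.add (integrable_const _)).const_mul _).div_const _
          rw [integral_add (hi2.div_const _) hi4, integral_div, integral_div,
            integral_const_mul, integral_add hi1 (integrable_const _), h1]
          simp
          ring
      _ ≤ K * t ^ 2 / t + t := by gcongr
      _ = (K + 1) * t := by field_simp
  refine ciSup_le fun s => ?_
  have h2 : ν.real s.1 = ∫ x in s.1, (ν.rnDeriv μ x).toReal ∂μ :=
    (Measure.setIntegral_toReal_rnDeriv hac s.1).symm
  have h3 : μ.real s.1 = ∫ x in s.1, (1 : ℝ) ∂μ := by simp
  rw [abs_sub_comm, h2, h3, ← integral_sub hi1.integrableOn (integrable_const _)]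
  calc |∫ x in s.1, ((ν.rnDeriv μ x).toReal - 1) ∂μ|
      ≤ ∫ x in s.1, |(ν.rnDeriv μ x).toReal - 1| ∂μ := abs_integral_le_integral_abs
    _ ≤ ∫ x, |(ν.rnDeriv μ x).toReal - 1| ∂μ :=
        setIntegral_le_integral hi3.abs (ae_of_all _ fun x => abs_nonneg _)
    _ ≤ _ := hmain

/-- Since e^x (1 − x) ≤ 1, the left side is at most x (e^x − 1); this is bounded by x² e^x for x ≥ 0
and by x² for x ≤ 0. -/
lemma exp_sub_one_sub_le (x : ℝ) : Real.exp x - 1 - x ≤ x ^ 2 * (1 + Real.exp x) := by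
  have h1 : 1 - x ≤ Real.exp (-x) := Real.one_sub_le_exp_neg x
  have h2 := Real.exp_pos x
  have h3 : Real.exp x * Real.exp (-x) = 1 := by rw [← Real.exp_add]; simp
  have h4 : Real.exp x * (1 - x) ≤ 1 := by nlinarith
  have h5 := Real.add_one_le_exp x
  rcases le_total 0 x with hx | hx
  · nlinarith [mul_nonneg hx hx]
  · nlinarith [mul_nonneg (sq_nonneg x) h2.le,
      mul_nonneg (neg_nonneg.2 hx) (by linarith : 0 ≤ Real.exp x - 1 - x)]

/-- The Kullback–Leibler divergence of a probability measure from its exponential tilt by a small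
function is quadratic in that function. -/
lemma klDiv_tilted_right_le {Ω : Type*} [MeasurableSpace Ω] {ν : Measure Ω}
    [IsProbabilityMeasure ν] {F : Ω → ℝ} (hF : Integrable F ν)
    (hexp : Integrable (fun x => Real.exp (F x)) ν)
    (hsq : Integrable (fun x => F x ^ 2 * (1 + Real.exp (F x))) ν) :
    klDiv ν (ν.tilted F) ≤ ENNReal.ofReal (∫ x, F x ^ 2 * (1 + Real.exp (F x)) ∂ν) := by
  have := isProbabilityMeasure_tilted hexp
  have hself : llr ν ν =ᵐ[ν] 0 := llr_self ν
  have hself' : Integrable (llr ν ν) ν := (integrable_congr hself).2 (integrable_zero _ _ _)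
  rw [klDiv_of_ac_of_integrable (absolutelyContinuous_tilted hexp)
    (integrable_llr_tilted_right Measure.AbsolutelyContinuous.rfl hF hself' hexp),
    integral_llr_tilted_right Measure.AbsolutelyContinuous.rfl hF hexp hself',
    integral_congr_ae hself]
  refine ENNReal.ofReal_le_ofReal ?_
  -- With Z = ∫ exp F, the divergence is log Z − ∫ F; log Z ≤ Z − 1 bounds it by ∫ (exp F − 1 − F).
  have hlog := Real.log_le_sub_one_of_pos (integral_exp_pos hexp)
  have hle : ∫ x, (Real.exp (F x) - 1 - F x) ∂ν ≤ ∫ x, F x ^ 2 * (1 + Real.exp (F x)) ∂ν :=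
    integral_mono ((hexp.sub (integrable_const _)).sub hF) hsq fun x => exp_sub_one_sub_le _
  have hexp1 : Integrable (fun x => Real.exp (F x) - 1) ν := hexp.sub (integrable_const _)
  rw [integral_sub hexp1 hF, integral_sub hexp (integrable_const _)] at hle
  simp at hle ⊢
  linarith

/-! ### Exponential tilts -/

lemma tilted_map_equiv {Ω Ω' : Type*} [MeasurableSpace Ω] [MeasurableSpace Ω']
    (μ : Measure Ω) (e : Ω ≃ᵐ Ω') (f : Ω' → ℝ) :
    (μ.map e).tilted f = (μ.tilted (f ∘ e)).map e := by
  ext s hs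
  rw [tilted_apply' _ _ hs, Measure.map_apply e.measurable hs,
    tilted_apply' _ _ (e.measurable hs), e.restrict_map, lintegral_map_equiv]
  simp only [Function.comp_apply, integral_map_equiv]

lemma smul_tilted {Ω : Type*} [MeasurableSpace Ω] (μ : Measure Ω) (f : Ω → ℝ) {c : ENNReal}
    (h0 : c ≠ 0) (htop : c ≠ ⊤) : (c • μ).tilted f = μ.tilted f := by
  ext s hs
  have hc : 0 < c.toReal := ENNReal.toReal_pos h0 htop
  rw [tilted_apply' _ _ hs, tilted_apply' _ _ hs, Measure.restrict_smul, lintegral_smul_measure,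
    integral_smul_measure, smul_eq_mul, ← lintegral_const_mul' _ _ htop]
  congr 1 with x
  rw [← ENNReal.ofReal_toReal htop, ← ENNReal.ofReal_mul hc.le, ENNReal.toReal_ofReal hc.le,
    smul_eq_mul, ← mul_div_assoc, mul_div_mul_left _ _ hc.ne']

lemma tilted_add_const {Ω : Type*} [MeasurableSpace Ω] (μ : Measure Ω) (f : Ω → ℝ) (c : ℝ) :
    (μ.tilted fun x => f x + c) = μ.tilted f := by
  simp only [Measure.tilted, Real.exp_add, integral_mul_const,
    mul_div_mul_right _ _ (Real.exp_pos c).ne']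

/-! ### The standard Gaussian -/

section stdGaussian

variable {E : Type*} [NormedAddCommGroup E] [InnerProductSpace ℝ E] [FiniteDimensional ℝ E]
  [MeasurableSpace E] [BorelSpace E]

lemma integrable_exp_neg_mul_sq_norm {b : ℝ} (hb : 0 < b) :
    Integrable fun v : E => Real.exp (-b * ‖v‖ ^ 2) := by
  have h := (GaussianFourier.integrable_cexp_neg_mul_sq_norm_add (V := E) (b := (b : ℂ))
    (by simpa using hb) 0 0).norm
  refine h.congr (ae_of_all _ fun v => ?_)
  simp [Complex.norm_exp, ← Complex.ofReal_pow]

lemma stdGaussian_eq_tilted :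
    stdGaussian E = (volume : Measure E).tilted fun v => -(1 / 2) * ‖v‖ ^ 2 := by
  have hint := integrable_exp_neg_mul_sq_norm (E := E) (b := 1 / 2) (by norm_num)
  have := isProbabilityMeasure_tilted hint
  refine Measure.ext_of_charFun (E := E) ?_
  ext t
  rw [charFun_stdGaussian, charFun_apply, integral_tilted]
  have hZ := GaussianFourier.integral_cexp_neg_mul_sq_norm (V := E) (b := ((1 / 2 : ℝ) : ℂ))
    (by norm_num)
  have hN := GaussianFourier.integral_cexp_neg_mul_sq_norm_add (V := E) (b := ((1 / 2 : ℝ) : ℂ))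
    (by norm_num) Complex.I t
  set Z : ℝ := ∫ v : E, Real.exp (-(1 / 2) * ‖v‖ ^ 2) with hZdef
  have hZpos : 0 < Z := integral_exp_pos hint
  have hZ' : ((Z : ℝ) : ℂ) = ∫ v : E, Complex.exp (-((1 / 2 : ℝ) : ℂ) * ‖v‖ ^ 2) := by
    rw [hZdef, ← integral_complex_ofReal]
    congr 1 with v
    push_cast
    rfl
  rw [← hZ, ← hZ'] at hN
  have h1 : ∀ v : E, (Real.exp (-(1 / 2) * ‖v‖ ^ 2) / Z) • Complex.exp (inner ℝ v t * Complex.I)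
      = (Z : ℂ)⁻¹ * Complex.exp (-((1 / 2 : ℝ) : ℂ) * ‖v‖ ^ 2 + Complex.I * inner ℝ t v) := by
    intro v
    rw [Complex.exp_add, Complex.real_smul, real_inner_comm, mul_comm Complex.I]
    push_cast
    ring
  simp_rw [h1]
  rw [integral_const_mul, hN, ← mul_assoc,
    inv_mul_cancel₀ (Complex.ofReal_ne_zero.2 hZpos.ne'), one_mul, Complex.I_sq]
  congr 1
  push_cast
  ring

lemma integrable_exp_mul_sq_norm_stdGaussian {s : ℝ} (hs : s < 1 / 2) :
    Integrable (fun v : E => Real.exp (s * ‖v‖ ^ 2)) (stdGaussian E) := by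
  rw [stdGaussian_eq_tilted,
    integrable_tilted_iff (integrable_exp_neg_mul_sq_norm (by norm_num : (0 : ℝ) < 1 / 2))]
  refine (integrable_exp_neg_mul_sq_norm (E := E) (b := 1 / 2 - s) (by linarith)).congr
    (ae_of_all _ fun v => ?_)
  simp only [smul_eq_mul, ← Real.exp_add]
  congr 1
  ring

lemma exists_stdGaussian_norm_gt_le {δ : ℝ} (hδ : 0 < δ) :
    ∃ R : ℝ, 0 < R ∧ (stdGaussian E).real {v | R < ‖v‖} ≤ δ := by
  have h := isTightMeasureSet_iff_exists_isCompact_measure_compl_le.1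
    (isTightMeasureSet_singleton_of_innerRegular (μ := stdGaussian E))
    (ENNReal.ofReal δ) (ENNReal.ofReal_pos.2 hδ)
  obtain ⟨K, hK, hK'⟩ := h
  obtain ⟨R, hR⟩ := hK.isBounded.exists_norm_le
  refine ⟨max R 1, by positivity, ENNReal.toReal_le_of_le_ofReal hδ.le ?_⟩
  refine (measure_mono fun v hv hvK => ?_).trans (hK' _ rfl)
  exact absurd (hR v hvK) (not_le.2 ((le_max_left _ _).trans_lt hv))

end stdGaussian

/-- The covariance is L Lᵀ, identified through characteristic functions. This makes the competitor
admissible. -/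
lemma map_stdGaussian_mem_gaussianMeasures {d : ℕ} (m : Vec d) (L : Vec d →L[ℝ] Vec d) :
    (stdGaussian (Vec d)).map (fun w => m + L w) ∈ gaussianMeasures d := by
  obtain ⟨M, hM⟩ : ∃ M : Matrix (Fin d) (Fin d) ℝ, Matrix.toEuclideanCLM (𝕜 := ℝ) M = L :=
    (Matrix.toEuclideanCLM (n := Fin d) (𝕜 := ℝ)).surjective L
  refine ⟨m, M * M.conjTranspose, Matrix.posSemidef_self_mul_conjTranspose M, ?_⟩
  have := Measure.isProbabilityMeasure_map (μ := stdGaussian (Vec d)) (f := fun w => m + L w)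
    (by fun_prop)
  refine Measure.ext_of_charFun (E := Vec d) ?_
  ext t
  rw [charFun_multivariateGaussian (Matrix.posSemidef_self_mul_conjTranspose M), charFun_apply,
    integral_map (by fun_prop) (by fun_prop)]
  have h1 : ∀ w : Vec d, Complex.exp (inner ℝ (m + L w) t * Complex.I) =
      Complex.exp (inner ℝ t m * Complex.I) *
        Complex.exp (inner ℝ w (L.adjoint t) * Complex.I) := by
    intro w
    rw [← Complex.exp_add, inner_add_left, ContinuousLinearMap.adjoint_inner_right,
      real_inner_comm]
    push_cast
    ring_nf
  simp_rw [h1]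
  rw [integral_const_mul, ← charFun_apply, charFun_stdGaussian, ← Complex.exp_add]
  congr 1
  have h2 : t.ofLp ⬝ᵥ (M * M.conjTranspose).mulVec t.ofLp = ‖L.adjoint t‖ ^ 2 := by
    rw [← Matrix.inner_toEuclideanCLM, map_mul, ← Matrix.star_eq_conjTranspose, map_star, hM,
      mul_apply_eq_comp, ContinuousLinearMap.star_eq_adjoint,
      ← ContinuousLinearMap.adjoint_inner_left, real_inner_self_eq_norm_sq]
  rw [h2]
  push_cast
  ring

/-! ### Expansions with remainder estimates on the whole space -/

lemma norm_add_le_mul_exp {E F : Type*} [NormedAddCommGroup E] [NormedAddCommGroup F] {f : E → F}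
    {C b : ℝ} (hC : 0 ≤ C) (hb : 0 ≤ b)
    (hgrowth : ∀ x, ‖f x‖ ≤ C * Real.exp (b * ‖x‖ ^ 2)) (x z : E) :
    ‖f (x + z)‖ ≤ C * Real.exp (2 * b * ‖x‖ ^ 2) * Real.exp (2 * b * ‖z‖ ^ 2) := by
  refine (hgrowth _).trans ?_
  rw [mul_assoc, ← Real.exp_add]
  gcongr
  have h1 : ‖x + z‖ ^ 2 ≤ (‖x‖ + ‖z‖) ^ 2 := by gcongr; exact norm_add_le _ _
  have h2 : ‖x + z‖ ^ 2 ≤ 2 * ‖x‖ ^ 2 + 2 * ‖z‖ ^ 2 := by nlinarith [sq_nonneg (‖x‖ - ‖z‖)]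
  nlinarith

section Taylor

variable {E F : Type*} [NormedAddCommGroup E] [NormedSpace ℝ E] [ProperSpace E]
  [NormedAddCommGroup F] [NormedSpace ℝ F]

lemma exists_norm_sub_le_of_norm_le_one {f : E → F} (hf : ContDiff ℝ 1 f) (x : E) :
    ∃ K : ℝ, 0 ≤ K ∧ ∀ z : E, ‖z‖ ≤ 1 → ‖f (x + z) - f x‖ ≤ K * ‖z‖ := by
  obtain ⟨K, hK⟩ := (isCompact_closedBall x 1).exists_bound_of_continuousOn
    (hf.continuous_fderiv one_ne_zero).continuousOn
  refine ⟨K, (norm_nonneg _).trans (hK x (by simp)), fun z hz => ?_⟩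
  have h := (convex_closedBall x 1).norm_image_sub_le_of_norm_fderiv_le (𝕜 := ℝ) (f := f)
    (fun y _ => (hf.differentiable one_ne_zero) y) hK (x := x) (y := x + z) (by simp) (by simpa)
  simpa using h

lemma exists_norm_sub_sub_fderiv_le_of_norm_le_one {f : E → F} (hf : ContDiff ℝ 2 f) (x : E) :
    ∃ K : ℝ, 0 ≤ K ∧ ∀ z : E, ‖z‖ ≤ 1 → ‖f (x + z) - f x - fderiv ℝ f x z‖ ≤ K * ‖z‖ ^ 2 := by
  obtain ⟨K, hK0, hK⟩ := exists_norm_sub_le_of_norm_le_one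
    (hf.fderiv_right (m := 1) (by norm_num)) x
  refine ⟨K, hK0, fun z hz => ?_⟩
  have h := (convex_closedBall x ‖z‖).norm_image_sub_le_of_norm_fderiv_le' (𝕜 := ℝ) (f := f)
    (φ := fderiv ℝ f x) (C := K * ‖z‖)
    (fun y _ => (hf.differentiable two_ne_zero) y) (fun y hy => ?_)
    (x := x) (y := x + z) (by simp) (by simp)
  · rw [add_sub_cancel_left] at h
    linarith
  · have hy' : ‖y - x‖ ≤ ‖z‖ := by simpa [dist_eq_norm] using hy
    have h1 := hK (y - x) (hy'.trans hz)
    rw [add_sub_cancel] at h1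
    exact h1.trans (by gcongr)

/-- Compactness controls the derivative on the unit ball; outside it 1 ≤ ‖z‖, so the growth bound
alone suffices. The exponent doubles because ‖x + z‖² ≤ 2‖x‖² + 2‖z‖². -/
lemma exists_norm_sub_le_mul_exp {f : E → F} (hf : ContDiff ℝ 1 f) (x : E) {C b : ℝ}
    (hC : 0 ≤ C) (hb : 0 ≤ b) (hgrowth : ∀ x, ‖f x‖ ≤ C * Real.exp (b * ‖x‖ ^ 2)) :
    ∃ K : ℝ, 0 ≤ K ∧ ∀ z : E, ‖f (x + z) - f x‖ ≤ K * ‖z‖ * Real.exp (2 * b * ‖z‖ ^ 2) := by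
  obtain ⟨K, hK0, hK⟩ := exists_norm_sub_le_of_norm_le_one hf x
  set D := C * Real.exp (2 * b * ‖x‖ ^ 2)
  refine ⟨K + (D + ‖f x‖), by positivity, fun z => ?_⟩
  have he : 1 ≤ Real.exp (2 * b * ‖z‖ ^ 2) := Real.one_le_exp (by positivity)
  have hD : 0 ≤ D := by positivity
  rcases le_total ‖z‖ 1 with hz | hz
  · calc ‖f (x + z) - f x‖ ≤ K * ‖z‖ := hK z hz
      _ ≤ (K + (D + ‖f x‖)) * ‖z‖ * 1 := by
        rw [mul_one]; gcongr; linarith [norm_nonneg (f x)]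
      _ ≤ _ := by gcongr
  · calc ‖f (x + z) - f x‖ ≤ ‖f (x + z)‖ + ‖f x‖ := norm_sub_le _ _
      _ ≤ D * Real.exp (2 * b * ‖z‖ ^ 2) + ‖f x‖ * Real.exp (2 * b * ‖z‖ ^ 2) := by
        gcongr
        · exact norm_add_le_mul_exp hC hb hgrowth x z
        · exact le_mul_of_one_le_right (norm_nonneg _) he
      _ = (D + ‖f x‖) * 1 * Real.exp (2 * b * ‖z‖ ^ 2) := by ring
      _ ≤ _ := mul_le_mul_of_nonneg_right
        (mul_le_mul (le_add_of_nonneg_left hK0) hz zero_le_one (by positivity)) (by positivity)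

lemma exists_norm_sub_sub_fderiv_le_mul_exp {f : E → F} (hf : ContDiff ℝ 2 f) (x : E) {C b : ℝ}
    (hC : 0 ≤ C) (hb : 0 ≤ b) (hgrowth : ∀ x, ‖f x‖ ≤ C * Real.exp (b * ‖x‖ ^ 2)) :
    ∃ K : ℝ, 0 ≤ K ∧ ∀ z : E,
      ‖f (x + z) - f x - fderiv ℝ f x z‖ ≤ K * ‖z‖ ^ 2 * Real.exp (2 * b * ‖z‖ ^ 2) := by
  obtain ⟨K, hK0, hK⟩ := exists_norm_sub_sub_fderiv_le_of_norm_le_one hf x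
  obtain ⟨K', hK0', hK'⟩ := exists_norm_sub_le_mul_exp (hf.of_le (by norm_num)) x hC hb hgrowth
  refine ⟨K + (K' + ‖fderiv ℝ f x‖), by positivity, fun z => ?_⟩
  have he : 1 ≤ Real.exp (2 * b * ‖z‖ ^ 2) := Real.one_le_exp (by positivity)
  rcases le_total ‖z‖ 1 with hz | hz
  · calc ‖f (x + z) - f x - fderiv ℝ f x z‖ ≤ K * ‖z‖ ^ 2 := hK z hz
      _ ≤ (K + (K' + ‖fderiv ℝ f x‖)) * ‖z‖ ^ 2 * 1 := by
        rw [mul_one]; gcongr; linarith [norm_nonneg (fderiv ℝ f x)]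
      _ ≤ _ := by gcongr
  · calc ‖f (x + z) - f x - fderiv ℝ f x z‖
        ≤ ‖f (x + z) - f x‖ + ‖fderiv ℝ f x z‖ := norm_sub_le _ _
      _ ≤ K' * ‖z‖ * Real.exp (2 * b * ‖z‖ ^ 2)
          + ‖fderiv ℝ f x‖ * ‖z‖ * Real.exp (2 * b * ‖z‖ ^ 2) := by
        gcongr
        · exact hK' z
        · exact ((fderiv ℝ f x).le_opNorm z).trans (le_mul_of_one_le_right (by positivity) he)
      _ = (K' + ‖fderiv ℝ f x‖) * ‖z‖ * Real.exp (2 * b * ‖z‖ ^ 2) := by ring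
      _ ≤ _ := mul_le_mul_of_nonneg_right
        (mul_le_mul (le_add_of_nonneg_left hK0) (le_self_pow₀ hz two_ne_zero) (norm_nonneg _)
          (by positivity)) (by positivity)

end Taylor

/-- A coercive map that takes the value `G x₀` only at `x₀` and has an invertible derivative there
moves away from that value at least linearly. -/
lemma exists_mul_norm_sub_le_norm_sub {E F : Type*} [NormedAddCommGroup E] [NormedSpace ℝ E]
    [ProperSpace E] [NormedAddCommGroup F] [NormedSpace ℝ F] {G : E → F} {x₀ : E}
    (hG : Continuous G) (hinj : ∀ x, G x = G x₀ → x = x₀) (A : E ≃L[ℝ] F)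
    (hA : HasFDerivAt G (A : E →L[ℝ] F) x₀) {c₀ c₁ : ℝ} (hc₁ : 0 < c₁)
    (hcoer : ∀ x, -c₀ + c₁ * ‖x‖ ^ 2 ≤ 1 / 2 * ‖G x - G x₀‖ ^ 2) :
    ∃ c : ℝ, 0 < c ∧ ∀ x, c * ‖x - x₀‖ ≤ ‖G x - G x₀‖ := by
  obtain ⟨a, ha, hloc⟩ : ∃ a : ℝ, 0 < a ∧ ∀ᶠ x in 𝓝 x₀, a * ‖x - x₀‖ ≤ ‖G x - G x₀‖ := by
    set N := ‖(A.symm : F →L[ℝ] E)‖ + 1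
    have hN : 0 < N := by positivity
    refine ⟨1 / (2 * N), by positivity, ?_⟩
    filter_upwards [hA.isLittleO.def (c := 1 / (2 * N)) (by positivity)] with x hx
    have h1 : ‖x - x₀‖ ≤ N * ‖A (x - x₀)‖ := by
      calc ‖x - x₀‖ = ‖(A.symm : F →L[ℝ] E) (A (x - x₀))‖ := by simp
        _ ≤ ‖(A.symm : F →L[ℝ] E)‖ * ‖A (x - x₀)‖ := ContinuousLinearMap.le_opNorm _ _
        _ ≤ _ := by gcongr; simp [N]
    have h2 : ‖A (x - x₀)‖ ≤ ‖G x - G x₀‖ + ‖G x - G x₀ - A (x - x₀)‖ := by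
      simpa using norm_sub_le (G x - G x₀) (G x - G x₀ - A (x - x₀))
    have h3 : 1 / N * ‖x - x₀‖ ≤ ‖A (x - x₀)‖ := by
      rw [one_div, inv_mul_le_iff₀ hN]; exact h1
    have h4 : 1 / N = 1 / (2 * N) + 1 / (2 * N) := by field_simp; norm_num
    have h5 : ‖G x - G x₀ - A (x - x₀)‖ ≤ 1 / (2 * N) * ‖x - x₀‖ := hx
    rw [h4, add_mul] at h3
    linarith
  obtain ⟨r, hr, hball⟩ := Metric.eventually_nhds_iff.1 hloc
  -- Coercivity gives ‖G x − G x₀‖² ≥ c₁‖x − x₀‖² − 2B, and beyond radius ρ the term 2B is at most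
  -- half of c₁‖x − x₀‖².
  set B := c₁ * ‖x₀‖ ^ 2 + |c₀|
  set ρ := √(4 * B / c₁) + 1
  have hB : 0 ≤ B := by positivity
  have hρ : 0 < ρ := by positivity
  have hρB : 4 * B / c₁ ≤ ρ ^ 2 := by
    have h := Real.sq_sqrt (show 0 ≤ 4 * B / c₁ by positivity)
    have h' := Real.sqrt_nonneg (4 * B / c₁)
    simp only [ρ]
    nlinarith
  have hfar : ∀ x, ρ ≤ ‖x - x₀‖ → min 1 (c₁ / 2) * ‖x - x₀‖ ≤ ‖G x - G x₀‖ := by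
    intro x hx
    have h1 : ‖x - x₀‖ ^ 2 ≤ 2 * ‖x‖ ^ 2 + 2 * ‖x₀‖ ^ 2 := by
      have : ‖x - x₀‖ ^ 2 ≤ (‖x‖ + ‖x₀‖) ^ 2 := by gcongr; exact norm_sub_le _ _
      nlinarith [sq_nonneg (‖x‖ - ‖x₀‖)]
    have h2 : 4 * B ≤ c₁ * ‖x - x₀‖ ^ 2 := by
      have h := hρB.trans (by gcongr : ρ ^ 2 ≤ ‖x - x₀‖ ^ 2)
      rwa [div_le_iff₀ hc₁, mul_comm (_ ^ 2)] at h
    have h3 : c₁ / 2 * ‖x - x₀‖ ^ 2 ≤ ‖G x - G x₀‖ ^ 2 := by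
      have := hcoer x
      have := le_abs_self c₀
      have := mul_le_mul_of_nonneg_left h1 hc₁.le
      simp only [B] at h2
      linarith
    refine le_of_sq_le_sq ?_ (norm_nonneg _)
    have h4 : min 1 (c₁ / 2) ^ 2 ≤ c₁ / 2 := by
      have h5 : 0 ≤ min 1 (c₁ / 2) := by positivity
      have h6 := min_le_left 1 (c₁ / 2)
      have h7 := min_le_right 1 (c₁ / 2)
      nlinarith
    calc (min 1 (c₁ / 2) * ‖x - x₀‖) ^ 2 = min 1 (c₁ / 2) ^ 2 * ‖x - x₀‖ ^ 2 := by ring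
      _ ≤ c₁ / 2 * ‖x - x₀‖ ^ 2 := by gcongr
      _ ≤ _ := h3
  -- On the remaining annulus injectivity at `x₀` and compactness give a positive lower bound.
  have hcpt : IsCompact (Metric.closedBall x₀ ρ \ Metric.ball x₀ r) :=
    (isCompact_closedBall x₀ ρ).diff Metric.isOpen_ball
  obtain ⟨m, hm, hmid⟩ := hcpt.exists_forall_le' (f := fun x => ‖G x - G x₀‖) (a := 0)
    (by fun_prop) fun x hx => by
      refine norm_pos_iff.2 (sub_ne_zero.2 fun h => hx.2 ?_)
      rw [hinj x h]
      exact Metric.mem_ball_self hr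
  refine ⟨min a (min (min 1 (c₁ / 2)) (m / ρ)), by positivity, fun x => ?_⟩
  rcases lt_or_ge ‖x - x₀‖ r with hx | hx
  · refine le_trans ?_ (hball (by rwa [dist_eq_norm]))
    gcongr
    exact min_le_left _ _
  rcases le_total ρ ‖x - x₀‖ with hx' | hx'
  · refine le_trans ?_ (hfar x hx')
    exact mul_le_mul_of_nonneg_right ((min_le_right _ _).trans (min_le_left _ _)) (norm_nonneg _)
  · refine le_trans ?_ (hmid x ⟨by simpa [dist_eq_norm], by simpa [dist_eq_norm] using hx⟩)
    calc min a (min (min 1 (c₁ / 2)) (m / ρ)) * ‖x - x₀‖ ≤ m / ρ * ρ := by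
          gcongr
          exact (min_le_right _ _).trans (min_le_right _ _)
      _ = m := by field_simp

/-! ### The posterior in the rescaled variable -/

/-- The logarithm of the density, up to normalization, of the posterior with respect to the
Gaussian law of `xt + √ε A⁻¹ (η + w)`, where `w` is standard Gaussian, as a function of `w`. -/
noncomputable def logRatio {d : ℕ} (G : Vec d → Vec d) (V₀ : Vec d → ℝ) (xt : Vec d)
    (A : Vec d ≃L[ℝ] Vec d) (ε : ℝ) (η w : Vec d) : ℝ :=
  -(1 / ε) * misfit G xt η ε (xt + √ε • A.symm (η + w)) - V₀ (xt + √ε • A.symm (η + w)) + V₀ xt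
    + 1 / 2 * ‖w‖ ^ 2

/-- An affine change of variables scales Lebesgue measure by a constant, which normalization cancels
(`smul_tilted`); the additive constant `V₀ xt` disappears likewise (`tilted_add_const`). -/
lemma posterior_eq_map {d : ℕ} (G : Vec d → Vec d) (V₀ : Vec d → ℝ) (xt : Vec d)
    (A : Vec d ≃L[ℝ] Vec d) {ε : ℝ} (hε : 0 < ε) (η : Vec d) :
    posterior G V₀ xt ε η = ((stdGaussian (Vec d)).tilted (logRatio G V₀ xt A ε η)).map
      (fun w => xt + √ε • A.symm (η + w)) := by
  have hs : √ε ≠ 0 := (Real.sqrt_pos.2 hε).ne'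
  let L : Vec d ≃L[ℝ] Vec d := A.symm.trans (ContinuousLinearEquiv.smulLeft (Units.mk0 (√ε) hs))
  let p := xt + √ε • A.symm η
  let e : Vec d ≃ᵐ Vec d := (L.toHomeomorph.trans (Homeomorph.addLeft p)).toMeasurableEquiv
  have he : ∀ w, e w = xt + √ε • A.symm (η + w) := by
    intro w
    change xt + √ε • A.symm η + √ε • A.symm w = _
    rw [map_add, smul_add, add_assoc]
  have hvol : ∃ c : ENNReal, c ≠ 0 ∧ c ≠ ⊤ ∧ (volume : Measure (Vec d)).map e = c • volume := by
    have h1 : (volume : Measure (Vec d)).map e = ((volume : Measure (Vec d)).map L) := by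
      have h : (e : Vec d → Vec d) = (fun x => p + x) ∘ L := rfl
      rw [h, ← Measure.map_map (by fun_prop) (by fun_prop)]
      have := ContinuousLinearEquiv.isAddHaarMeasure_map L (volume : Measure (Vec d))
      exact map_add_left_eq_self _ p
    have := ContinuousLinearEquiv.isAddHaarMeasure_map L (volume : Measure (Vec d))
    refine ⟨Measure.addHaarScalarFactor ((volume : Measure (Vec d)).map L) volume, ?_,
      ENNReal.coe_ne_top, ?_⟩
    · exact_mod_cast (Measure.addHaarScalarFactor_pos_of_isAddHaarMeasure _ _).ne'
    · rw [h1]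
      exact Measure.isAddLeftInvariant_eq_smul _ _
  obtain ⟨c, hc0, hc, hvol⟩ := hvol
  have he' : (fun w => xt + √ε • A.symm (η + w)) = e := funext fun w => (he w).symm
  rw [he', stdGaussian_eq_tilted,
    tilted_tilted (integrable_exp_neg_mul_sq_norm (by norm_num : (0 : ℝ) < 1 / 2)), posterior,
    ← smul_tilted volume _ hc0 hc, ← hvol, tilted_map_equiv, ← tilted_add_const _ _ (V₀ xt)]
  congr 2
  ext w
  simp only [Function.comp_apply, he, Pi.add_apply, logRatio]
  ring

lemma exists_le_mul_exp_sq {τ : ℝ} (hτ : 0 < τ) :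
    ∃ Q : ℝ, 1 ≤ Q ∧ (∀ u : ℝ, u ^ 2 ≤ Q * Real.exp (τ * u ^ 2)) ∧
      ∀ u : ℝ, u ≤ Q * Real.exp (τ * u ^ 2) := by
  have h2 : ∀ u : ℝ, u ^ 2 ≤ 1 / τ * Real.exp (τ * u ^ 2) := fun u => by
    rw [one_div, inv_mul_eq_div, le_div_iff₀ hτ]
    linarith [Real.add_one_le_exp (τ * u ^ 2)]
  have h1 : ∀ u : ℝ, 1 ≤ Real.exp (τ * u ^ 2) := fun u => Real.one_le_exp (by positivity)
  refine ⟨1 + 1 / τ, by linarith [one_div_pos.2 hτ], fun u => ?_, fun u => ?_⟩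
  · linarith [h1 u, h2 u]
  · nlinarith [h1 u, h2 u, sq_nonneg (u - 1)]

section logRatio

variable {d : ℕ} {G : Vec d → Vec d} {V₀ : Vec d → ℝ} {xt : Vec d} {A : Vec d ≃L[ℝ] Vec d}

/-- As A z = √ε(η + w), the noise cancels and the residual is −(r + √ε w). Its ‖w‖²/2 contribution
is the Gaussian weight; since the Taylor remainder r is O(ε), what is left is O(√ε). -/
lemma logRatio_eq {ε : ℝ} (hε : 0 < ε) (η w : Vec d) {z r : Vec d}
    (hz : z = √ε • A.symm (η + w)) (hr : r = G (xt + z) - G xt - A z) :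
    logRatio G V₀ xt A ε η w
      = -(‖r‖ ^ 2 / (2 * ε)) - inner ℝ r w / √ε - (V₀ (xt + z) - V₀ xt) := by
  have hs : 0 < √ε := Real.sqrt_pos.2 hε
  have hAz : A z = √ε • (η + w) := by rw [hz, map_smul, A.apply_symm_apply]
  have h1 : G xt - G (xt + z) + √ε • η = -(r + √ε • w) := by
    rw [hr, hAz, smul_add]; abel
  rw [logRatio, misfit, ← hz, h1, norm_neg, norm_add_sq_real, norm_smul, inner_smul_right,
    Real.norm_of_nonneg hs.le]
  obtain ⟨s, rfl⟩ : ∃ s, s = √ε := ⟨_, rfl⟩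
  have h2 : ε = √ε ^ 2 := (Real.sq_sqrt hε.le).symm
  generalize √ε = s at *
  subst h2
  field_simp
  ring

lemma abs_logRatio_le_mul_exp_symm {K K' : ℝ} (hK : 0 ≤ K) (hK' : 0 ≤ K')
    (hG : ∀ z, ‖G (xt + z) - G xt - A z‖ ≤ K * ‖z‖ ^ 2 * Real.exp (2 * ‖z‖ ^ 2))
    (hV : ∀ z, ‖V₀ (xt + z) - V₀ xt‖ ≤ K' * ‖z‖ * Real.exp (2 * ‖z‖ ^ 2))
    {R : ℝ} (hR : 0 ≤ R) {τ : ℝ} (hτ : 0 < τ) :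
    ∃ C : ℝ, 0 ≤ C ∧ ∀ ε, 0 < ε → ε ≤ 1 → 2 * ε ≤ τ → ∀ η : Vec d, ‖η‖ ≤ R → ∀ w,
      |logRatio G V₀ xt A ε η w| ≤ C * √ε * Real.exp (τ * ‖A.symm (η + w)‖ ^ 2) ^ 4 := by
  obtain ⟨a, ha, hA⟩ : ∃ a : ℝ, 0 ≤ a ∧ ∀ v, ‖A v‖ ≤ a * ‖v‖ :=
    ⟨_, norm_nonneg _, (A : Vec d →L[ℝ] Vec d).le_opNorm⟩
  obtain ⟨Q, hQ, hQ2, hQ1⟩ : ∃ Q : ℝ, 1 ≤ Q ∧ (∀ u : ℝ, u ^ 2 ≤ Q * Real.exp (τ * u ^ 2)) ∧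
      ∀ u : ℝ, u ≤ Q * Real.exp (τ * u ^ 2) := exists_le_mul_exp_sq hτ
  -- The three summands bound the three terms of `logRatio_eq`. Powers of ‖y‖ and the factor
  -- exp(2‖z‖²) are absorbed into powers of X = exp(τ‖y‖²); the worst term, ‖r‖², needs X⁴.
  refine ⟨K ^ 2 * Q ^ 2 + K * Q * ((a + R) * Q) + K' * Q, by positivity, ?_⟩
  intro ε hε hε1 hετ η hη w
  obtain ⟨s, hs, hsε⟩ : ∃ s : ℝ, 0 < s ∧ s = √ε := ⟨_, Real.sqrt_pos.2 hε, rfl⟩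
  have hs2 : s ^ 2 = ε := by rw [hsε, Real.sq_sqrt hε.le]
  have hs1 : s ≤ 1 := by nlinarith
  obtain ⟨y, hy⟩ : ∃ y, y = A.symm (η + w) := ⟨_, rfl⟩
  obtain ⟨z, hz⟩ : ∃ z, z = √ε • A.symm (η + w) := ⟨_, rfl⟩
  obtain ⟨r, hr⟩ : ∃ r, r = G (xt + z) - G xt - A z := ⟨_, rfl⟩
  rw [logRatio_eq hε η w hz hr, ← hsε, ← hy]
  have hyX2 := hQ2 ‖y‖
  have hyX := hQ1 ‖y‖
  have hzy : ‖z‖ = s * ‖y‖ := by rw [hz, ← hy, ← hsε, norm_smul, Real.norm_of_nonneg hs.le]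
  have hX1 : 1 ≤ Real.exp (τ * ‖y‖ ^ 2) := Real.one_le_exp (by positivity)
  have hexp : Real.exp (2 * ‖z‖ ^ 2) ≤ Real.exp (τ * ‖y‖ ^ 2) := by
    refine Real.exp_le_exp.2 ?_
    rw [hzy, mul_pow, hs2, ← mul_assoc]
    gcongr
  generalize Real.exp (τ * ‖y‖ ^ 2) = X at *
  have hw : ‖w‖ ≤ (a + R) * Q * X := by
    have h1 : w = A y - η := by rw [hy, A.apply_symm_apply, add_sub_cancel_left]
    have h3 : ‖w‖ ≤ ‖A y‖ + ‖η‖ := by rw [h1]; exact norm_sub_le _ _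
    have h4 : R ≤ R * (Q * X) := le_mul_of_one_le_right hR (one_le_mul_of_one_le_of_one_le hQ hX1)
    have h5 := mul_le_mul_of_nonneg_left hyX ha
    linarith [hA y]
  have hrn : ‖r‖ ≤ K * s ^ 2 * Q * X ^ 2 := by
    calc ‖r‖ ≤ K * ‖z‖ ^ 2 * Real.exp (2 * ‖z‖ ^ 2) := hr ▸ hG z
      _ ≤ K * ‖z‖ ^ 2 * X := by gcongr
      _ = K * (s ^ 2 * ‖y‖ ^ 2) * X := by rw [hzy, mul_pow]
      _ ≤ K * (s ^ 2 * (Q * X)) * X := by gcongr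
      _ = _ := by ring
  have t1 : |‖r‖ ^ 2 / (2 * ε)| ≤ s * (K ^ 2 * Q ^ 2) * X ^ 4 := by
    rw [abs_of_nonneg (by positivity)]
    calc ‖r‖ ^ 2 / (2 * ε) ≤ (K * s ^ 2 * Q * X ^ 2) ^ 2 / (2 * ε) := by gcongr
      _ = (s * s) * (K ^ 2 * Q ^ 2) * X ^ 4 / 2 := by rw [← hs2]; field_simp
      _ ≤ (s * 1) * (K ^ 2 * Q ^ 2) * X ^ 4 / 2 := by gcongr
      _ ≤ _ := by
        rw [mul_one]; exact half_le_self (by positivity)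
  have t2 : |inner ℝ r w / s| ≤ s * (K * Q * ((a + R) * Q)) * X ^ 4 := by
    rw [abs_div, abs_of_pos hs]
    calc |inner ℝ r w| / s ≤ ‖r‖ * ‖w‖ / s := by gcongr; exact abs_real_inner_le_norm _ _
      _ ≤ (K * s ^ 2 * Q * X ^ 2) * ((a + R) * Q * X) / s := by gcongr
      _ = s * (K * Q * ((a + R) * Q)) * X ^ 3 := by field_simp
      _ ≤ _ := by gcongr; norm_num
  have t3 : |V₀ (xt + z) - V₀ xt| ≤ s * (K' * Q) * X ^ 4 := by
    calc |V₀ (xt + z) - V₀ xt| ≤ K' * ‖z‖ * Real.exp (2 * ‖z‖ ^ 2) := hV z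
      _ ≤ K' * ‖z‖ * X := by gcongr
      _ = K' * (s * ‖y‖) * X := by rw [hzy]
      _ ≤ K' * (s * (Q * X)) * X := by gcongr
      _ = s * (K' * Q) * X ^ 2 := by ring
      _ ≤ _ := by gcongr; norm_num
  have habs : ∀ p q t : ℝ, |-p - q - t| ≤ |p| + |q| + |t| := fun p q t => by
    rw [← abs_neg p]
    exact (abs_sub _ _).trans (add_le_add_left (abs_sub _ _) _)
  refine (habs _ _ _).trans ((add_le_add (add_le_add t1 t2) t3).trans_eq ?_)
  ring

lemma abs_logRatio_le {K K' : ℝ} (hK : 0 ≤ K) (hK' : 0 ≤ K')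
    (hG : ∀ z, ‖G (xt + z) - G xt - A z‖ ≤ K * ‖z‖ ^ 2 * Real.exp (2 * ‖z‖ ^ 2))
    (hV : ∀ z, ‖V₀ (xt + z) - V₀ xt‖ ≤ K' * ‖z‖ * Real.exp (2 * ‖z‖ ^ 2))
    {R : ℝ} (hR : 0 ≤ R) {θ : ℝ} (hθ : 0 < θ) :
    ∃ C : ℝ, 0 ≤ C ∧ ∃ ε₀ : ℝ, 0 < ε₀ ∧ ∀ ε, 0 < ε → ε < ε₀ → ∀ η : Vec d, ‖η‖ ≤ R → ∀ w,
      |logRatio G V₀ xt A ε η w| ≤ C * √ε * Real.exp (θ * ‖w‖ ^ 2) := by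
  obtain ⟨N, hN, hA⟩ : ∃ N : ℝ, 0 < N ∧ ∀ v, ‖A.symm v‖ ≤ N * ‖v‖ :=
    ⟨‖(A.symm : Vec d →L[ℝ] Vec d)‖ + 1, by positivity, fun v =>
      ((A.symm : Vec d →L[ℝ] Vec d).le_opNorm v).trans (by gcongr; linarith)⟩
  -- The fourth power and ‖A⁻¹(η + w)‖² ≤ 2N²(R² + ‖w‖²) together cost the factor 8N².
  obtain ⟨τ, hτ, hτθ⟩ : ∃ τ : ℝ, 0 < τ ∧ τ * (8 * N ^ 2) = θ :=
    ⟨θ / (8 * N ^ 2), by positivity, by field_simp⟩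
  obtain ⟨C, hC, hbound⟩ := abs_logRatio_le_mul_exp_symm hK hK' hG hV hR hτ
  refine ⟨C * Real.exp (θ * R ^ 2), by positivity, min 1 (τ / 2), by positivity, ?_⟩
  intro ε hε hε₀ η hη w
  refine (hbound ε hε (hε₀.le.trans (min_le_left _ _))
    (by linarith [hε₀.trans_le (min_le_right _ _)]) η hη w).trans ?_
  rw [mul_right_comm C (Real.exp _), mul_assoc (C * √ε), ← Real.exp_add, ← Real.exp_nat_mul]
  gcongr
  have h1 : ‖A.symm (η + w)‖ ≤ N * (R + ‖w‖) :=
    (hA _).trans (by gcongr; exact (norm_add_le _ _).trans (by gcongr))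
  calc ((4 : ℕ) : ℝ) * (τ * ‖A.symm (η + w)‖ ^ 2) ≤ 4 * (τ * (N * (R + ‖w‖)) ^ 2) := by
        push_cast; gcongr
    _ = 4 * τ * N ^ 2 * (R + ‖w‖) ^ 2 := by ring
    _ ≤ 4 * τ * N ^ 2 * (2 * R ^ 2 + 2 * ‖w‖ ^ 2) := by
      gcongr; nlinarith [sq_nonneg (R - ‖w‖)]
    _ = θ * R ^ 2 + θ * ‖w‖ ^ 2 := by rw [← hτθ]; ring

/-- The bound of `abs_logRatio_le` is useless inside an exponential, being itself exponential in
‖w‖². Here linear separation makes misfit/ε grow quadratically in `w`, uniformly in ε, and leaves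
part of the Gaussian decay. -/
lemma logRatio_le (hV : ∀ x, 0 ≤ V₀ x) {c : ℝ} (hc : 0 < c)
    (hG : ∀ x, c * ‖x - xt‖ ≤ ‖G x - G xt‖) {R : ℝ} :
    ∃ C κ : ℝ, 0 < κ ∧ κ ≤ 1 / 2 ∧ 0 ≤ C ∧ ∀ ε, 0 < ε → ∀ η : Vec d, ‖η‖ ≤ R → ∀ w,
      logRatio G V₀ xt A ε η w ≤ (1 / 2 - κ) * ‖w‖ ^ 2 + C := by
  set a := ‖(A : Vec d →L[ℝ] Vec d)‖ + 1
  have ha : 0 < a := by positivity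
  -- Chosen so that ‖w‖² ≤ 2a²‖y‖² + 2R² turns κ₀‖w‖² into the available c²‖y‖²/4 plus a constant.
  set κ₀ := c ^ 2 / (8 * a ^ 2) with hκ₀
  have hκ₀' : 0 < κ₀ := by positivity
  refine ⟨2 * κ₀ * R ^ 2 + R ^ 2 / 2 + V₀ xt, min κ₀ (1 / 2), by positivity, min_le_right _ _,
    by have := hV xt; positivity, ?_⟩
  intro ε hε η hη w
  set y := A.symm (η + w) with hy
  have hs : 0 < √ε := Real.sqrt_pos.2 hε
  have h1 : ‖η + w‖ ≤ a * ‖y‖ := by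
    calc ‖η + w‖ = ‖A y‖ := by rw [hy, A.apply_symm_apply]
      _ ≤ ‖(A : Vec d →L[ℝ] Vec d)‖ * ‖y‖ := (A : Vec d →L[ℝ] Vec d).le_opNorm y
      _ ≤ _ := by gcongr; simp [a]
  have hη2 : ‖η‖ ^ 2 ≤ R ^ 2 := by gcongr
  have h2 : ‖w‖ ^ 2 ≤ 2 * a ^ 2 * ‖y‖ ^ 2 + 2 * R ^ 2 := by
    have h3 : ‖w‖ ≤ ‖η + w‖ + ‖η‖ := by
      simpa using norm_sub_le (η + w) η
    have h4 : ‖η + w‖ ^ 2 ≤ (a * ‖y‖) ^ 2 := by gcongr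
    have h5 : ‖w‖ ^ 2 ≤ (‖η + w‖ + ‖η‖) ^ 2 := by gcongr
    nlinarith [sq_nonneg (‖η + w‖ - ‖η‖)]
  set x := xt + √ε • y with hx
  set D := G x - G xt
  have h3 : (c * √ε * ‖y‖) ^ 2 ≤ ‖D‖ ^ 2 := by
    have h := hG x
    rw [hx, add_sub_cancel_left, norm_smul, Real.norm_of_nonneg hs.le, ← mul_assoc] at h
    gcongr
  rw [mul_pow, mul_pow, Real.sq_sqrt hε.le] at h3
  have h4 : misfit G xt η ε x ≥ c ^ 2 * ε * ‖y‖ ^ 2 / 4 - ε * R ^ 2 / 2 := by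
    have h5 : G xt - G x + √ε • η = -(D - √ε • η) := by simp only [D]; abel
    have h6 : ‖D‖ ≤ ‖D - √ε • η‖ + √ε * ‖η‖ := by
      have h := norm_add_le (D - √ε • η) (√ε • η)
      rwa [sub_add_cancel, norm_smul, Real.norm_of_nonneg hs.le] at h
    have h7 : ‖D‖ ^ 2 ≤ (‖D - √ε • η‖ + √ε * ‖η‖) ^ 2 := by gcongr
    have h8 : (√ε * ‖η‖) ^ 2 ≤ ε * R ^ 2 := by
      rw [mul_pow, Real.sq_sqrt hε.le]; gcongr
    rw [misfit, h5, norm_neg]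
    nlinarith [sq_nonneg (‖D - √ε • η‖ - √ε * ‖η‖)]
  have h5 : 1 / ε * misfit G xt η ε x ≥ c ^ 2 * ‖y‖ ^ 2 / 4 - R ^ 2 / 2 := by
    have h : 1 / ε * misfit G xt η ε x ≥ 1 / ε * (c ^ 2 * ε * ‖y‖ ^ 2 / 4 - ε * R ^ 2 / 2) := by
      gcongr
    refine le_trans (le_of_eq ?_) h
    field_simp
  have h6 : κ₀ * ‖w‖ ^ 2 ≤ c ^ 2 * ‖y‖ ^ 2 / 4 + 2 * κ₀ * R ^ 2 := by
    calc κ₀ * ‖w‖ ^ 2 ≤ κ₀ * (2 * a ^ 2 * ‖y‖ ^ 2 + 2 * R ^ 2) := by gcongr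
      _ = _ := by rw [hκ₀]; field_simp; ring
  have h7 : min κ₀ (1 / 2) * ‖w‖ ^ 2 ≤ κ₀ * ‖w‖ ^ 2 := by gcongr; exact min_le_left _ _
  have h8 := hV x
  rw [logRatio, ← hy, ← hx]
  linarith

end logRatio

/-- The Laplace approximation: a Gaussian measure whose Kullback–Leibler divergence from the
posterior is of the order of `ε`, uniformly for bounded noise. -/
lemma exists_gaussian_klDiv_posterior_le {d : ℕ} {G : Vec d → Vec d} {V₀ : Vec d → ℝ}
    {xt : Vec d} {A : Vec d ≃L[ℝ] Vec d} (hGc : Continuous G) (hVc : Continuous V₀)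
    (hV0 : ∀ x, 0 ≤ V₀ x) {K K' c R : ℝ} (hK : 0 ≤ K) (hK' : 0 ≤ K') (hc : 0 < c) (hR : 0 ≤ R)
    (hG : ∀ z, ‖G (xt + z) - G xt - A z‖ ≤ K * ‖z‖ ^ 2 * Real.exp (2 * ‖z‖ ^ 2))
    (hV : ∀ z, ‖V₀ (xt + z) - V₀ xt‖ ≤ K' * ‖z‖ * Real.exp (2 * ‖z‖ ^ 2))
    (hGc' : ∀ x, c * ‖x - xt‖ ≤ ‖G x - G xt‖) :
    ∃ C : ℝ, 0 ≤ C ∧ ∃ ε₀ : ℝ, 0 < ε₀ ∧ ∀ ε, 0 < ε → ε < ε₀ → ∀ η : Vec d, ‖η‖ ≤ R →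
      IsProbabilityMeasure (posterior G V₀ xt ε η) ∧ ∃ ν ∈ gaussianMeasures d,
        klDiv ν (posterior G V₀ xt ε η) ≤ ENNReal.ofReal (C * ε) := by
  obtain ⟨C₁, κ, hκ, hκ2, hC₁, hup⟩ := logRatio_le (A := A) hV0 hc hGc' (R := R)
  -- With θ = κ/4, squaring F costs κ/2 in the exponent, so F² exp F still lies below exp((1/2 −
  -- κ/2)‖w‖²), which is γ-integrable.
  obtain ⟨C₂, hC₂, ε₀, hε₀, habs⟩ := abs_logRatio_le hK hK' hG hV hR
    (show 0 < κ / 4 by positivity)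
  set γ := stdGaussian (Vec d)
  set C₃ := C₂ ^ 2 * (1 + Real.exp C₁) with hC₃
  set I := ∫ w, Real.exp ((1 / 2 - κ / 2) * ‖w‖ ^ 2) ∂γ
  have hI0 : 0 ≤ I := integral_nonneg fun _ => (Real.exp_pos _).le
  refine ⟨C₃ * I, by positivity, ε₀, hε₀, fun ε hε hεε₀ η hη => ?_⟩
  set F := logRatio G V₀ xt A ε η with hF
  have hFc : Continuous F := by
    rw [hF]
    unfold logRatio misfit
    fun_prop
  have hb1 : ∀ w, |F w| ≤ C₂ * √ε * Real.exp (κ / 4 * ‖w‖ ^ 2) := habs ε hε hεε₀ η hη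
  have hb2 : ∀ w, Real.exp (F w) ≤ Real.exp C₁ * Real.exp ((1 / 2 - κ) * ‖w‖ ^ 2) := by
    intro w
    rw [← Real.exp_add, add_comm]
    exact Real.exp_le_exp.2 (hup ε hε η hη w)
  have hb3 : ∀ w, F w ^ 2 * (1 + Real.exp (F w))
      ≤ C₃ * ε * Real.exp ((1 / 2 - κ / 2) * ‖w‖ ^ 2) := by
    intro w
    have h1 : F w ^ 2 ≤ C₂ ^ 2 * ε * Real.exp (κ / 2 * ‖w‖ ^ 2) := by
      calc F w ^ 2 = |F w| ^ 2 := (sq_abs _).symm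
        _ ≤ (C₂ * √ε * Real.exp (κ / 4 * ‖w‖ ^ 2)) ^ 2 := by gcongr; exact hb1 w
        _ = _ := by
          rw [mul_pow, mul_pow, Real.sq_sqrt hε.le, ← Real.exp_nat_mul]
          congr 2
          push_cast
          ring
    have h2 : 1 + Real.exp (F w)
        ≤ (1 + Real.exp C₁) * Real.exp ((1 / 2 - κ) * ‖w‖ ^ 2) := by
      have h3 : 1 ≤ Real.exp ((1 / 2 - κ) * ‖w‖ ^ 2) :=
        Real.one_le_exp (mul_nonneg (by linarith) (sq_nonneg _))
      linarith [hb2 w]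
    calc F w ^ 2 * (1 + Real.exp (F w))
        ≤ (C₂ ^ 2 * ε * Real.exp (κ / 2 * ‖w‖ ^ 2))
          * ((1 + Real.exp C₁) * Real.exp ((1 / 2 - κ) * ‖w‖ ^ 2)) := by gcongr
      _ = C₃ * ε * (Real.exp (κ / 2 * ‖w‖ ^ 2) * Real.exp ((1 / 2 - κ) * ‖w‖ ^ 2)) := by
        rw [hC₃]; ring
      _ = _ := by
        rw [← Real.exp_add]
        congr 2
        ring
  have hFint : Integrable F γ :=
    ((integrable_exp_mul_sq_norm_stdGaussian (s := κ / 4) (by linarith)).const_mul (C₂ * √ε)).mono'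
      hFc.aestronglyMeasurable (ae_of_all _ hb1)
  have hexp : Integrable (fun w => Real.exp (F w)) γ :=
    ((integrable_exp_mul_sq_norm_stdGaussian (s := 1 / 2 - κ) (by linarith)).const_mul
      (Real.exp C₁)).mono' (by fun_prop) (ae_of_all _ fun w => by
        rw [Real.norm_of_nonneg (Real.exp_pos _).le]; exact hb2 w)
  have hdom : Integrable (fun w => C₃ * ε * Real.exp ((1 / 2 - κ / 2) * ‖w‖ ^ 2)) γ :=
    (integrable_exp_mul_sq_norm_stdGaussian (by linarith)).const_mul _
  have hsq : Integrable (fun w => F w ^ 2 * (1 + Real.exp (F w))) γ :=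
    hdom.mono' (by fun_prop) (ae_of_all _ fun w => by
      rw [Real.norm_of_nonneg (by positivity)]; exact hb3 w)
  have hprob := isProbabilityMeasure_tilted hexp
  have hT : Measurable fun w : Vec d => xt + √ε • A.symm (η + w) := by fun_prop
  have hpost := posterior_eq_map G V₀ xt A hε η
  rw [hpost]
  refine ⟨Measure.isProbabilityMeasure_map hT.aemeasurable,
    γ.map (fun w => xt + √ε • A.symm (η + w)), ?_, ?_⟩
  · convert map_stdGaussian_mem_gaussianMeasures (xt + √ε • A.symm η)
      (√ε • (A.symm : Vec d →L[ℝ] Vec d)) using 3 with w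
    simp [add_assoc]
  -- Data processing: pushing both measures forward does not increase the divergence.
  · refine (klDiv_map_le _ _ hT).trans ((klDiv_tilted_right_le hFint hexp hsq).trans
      (ENNReal.ofReal_le_ofReal ?_))
    calc ∫ w, F w ^ 2 * (1 + Real.exp (F w)) ∂γ
        ≤ ∫ w, C₃ * ε * Real.exp ((1 / 2 - κ / 2) * ‖w‖ ^ 2) ∂γ := integral_mono hsq hdom hb3
      _ = C₃ * I * ε := by rw [integral_const_mul]; ring

end BayesInverse

/-! ### Conclusion: from the divergence bound to total variation, with high probability in the
noise. -/

theorem corollary5p3 {d : ℕ}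
    (G : BayesInverse.Vec d → BayesInverse.Vec d) (V₀ : BayesInverse.Vec d → ℝ)
    (xt : BayesInverse.Vec d)
    -- the forward map
    (hG : ContDiff ℝ 4 G)
    (hinj : ∀ x, G x = G xt → x = xt)
    (hdiffeo : IsLocalDiffeomorphAt 𝓘(ℝ, BayesInverse.Vec d) 𝓘(ℝ, BayesInverse.Vec d) 1 G xt)
    -- the prior density is proportional to `exp (-V₀)`
    (hV₀ : Integrable (fun x => Real.exp (-V₀ x)))
    -- the growth conditions on the potentials, for every realization of the noise
    (hpot : ∀ η : BayesInverse.Vec d,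
      BayesInverse.GrowthConditions (BayesInverse.misfit G xt η) V₀) :
    ∀ δ : ℝ, 0 < δ → ∃ M : ℝ, 0 < M ∧ ∀ᶠ ε : ℝ in 𝓝[>] 0,
      ∀ ν : BayesInverse.Vec d → Measure (BayesInverse.Vec d),
        (∀ η, BayesInverse.IsBestGaussian (BayesInverse.posterior G V₀ xt ε η) (ν η)) →
        (stdGaussian (BayesInverse.Vec d)).real
          {η | M * √ε ≤ BayesInverse.tvDist (BayesInverse.posterior G V₀ xt ε η) (ν η)} ≤ δ := by
  open BayesInverse in
  intro δ hδ
  -- At zero noise the misfit is ½‖G x − G xt‖² for every ε. The growth conditions there become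
  -- statements about `G` itself, so the resulting constants do not depend on η.
  have hpot0 := hpot 0
  have hmis : ∀ ε x, misfit G xt 0 ε x = 1 / 2 * ‖G x - G xt‖ ^ 2 := by
    intro ε x
    rw [misfit, smul_zero, add_zero, norm_sub_rev]
  obtain ⟨A, hA⟩ : ∃ A : Vec d ≃L[ℝ] Vec d, (A : Vec d →L[ℝ] Vec d) = fderiv ℝ G xt :=
    ⟨hdiffeo.mfderivToContinuousLinearEquiv one_ne_zero, by
      rw [← mfderiv_eq_fderiv]; exact hdiffeo.mfderivToContinuousLinearEquiv_coe one_ne_zero⟩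
  obtain ⟨c, hc, hlin⟩ : ∃ c : ℝ, 0 < c ∧ ∀ x, c * ‖x - xt‖ ≤ ‖G x - G xt‖ := by
    obtain ⟨ε₀, hε₀, c₀, -, c₁, hc₁, h⟩ := hpot0.coercive
    refine exists_mul_norm_sub_le_norm_sub hG.continuous hinj A ?_ hc₁
      fun x => (h (ε₀ / 2) (by positivity) (by linarith) x).trans (hmis _ x).le
    rw [hA]
    exact ((hG.differentiable (by norm_num)) xt).hasFDerivAt
  obtain ⟨ε₁, hε₁, C, hC, hder⟩ := hpot0.derivBound
  have hder' := hder (ε₁ / 2) (by positivity) (by linarith)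
  -- Growth of `G` comes from the bound on the misfit (the case k = 0), via 2u ≤ u² + 1 with u = ‖G
  -- x − G xt‖.
  obtain ⟨K, hK, hGK⟩ := exists_norm_sub_sub_fderiv_le_mul_exp (hG.of_le (by norm_num)) xt
    (C := ‖G xt‖ + 1 + 2 * C) (b := 1) (by positivity) zero_le_one fun x => by
      have h1 := (hder' x).1 0 (by norm_num)
      rw [norm_iteratedFDeriv_zero, hmis, Real.norm_of_nonneg (by positivity)] at h1
      have h2 : ‖G x‖ ≤ ‖G x - G xt‖ + ‖G xt‖ := by simpa using norm_add_le (G x - G xt) (G xt)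
      have h3 : 1 ≤ Real.exp (‖x‖ ^ 2) := Real.one_le_exp (by positivity)
      rw [one_mul]
      nlinarith [sq_nonneg (‖G x - G xt‖ - 1), norm_nonneg (G xt)]
  obtain ⟨K', hK', hVK⟩ := exists_norm_sub_le_mul_exp (hpot0.contDiff_snd.of_le (by norm_num)) xt
    hC.le zero_le_one fun x => by
      have h1 := (hder' x).2 0 (by norm_num)
      rwa [norm_iteratedFDeriv_zero, ← one_mul (‖x‖ ^ 2)] at h1
  rw [mul_one] at hGK hVK
  rw [← hA] at hGK
  obtain ⟨R, hR, hRδ⟩ := exists_stdGaussian_norm_gt_le (E := Vec d) hδ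
  obtain ⟨D, hD, ε₀, hε₀, hkl⟩ := exists_gaussian_klDiv_posterior_le (A := A) hG.continuous
    hpot0.contDiff_snd.continuous hpot0.nonneg_snd hK hK' hc hR.le hGK hVK hlin
  -- Total variation is at most (D + 1)√ε when ‖η‖ ≤ R; one more unit contradicts the non-strict
  -- inequality defining the event.
  refine ⟨D + 2, by positivity, ?_⟩
  filter_upwards [Ioo_mem_nhdsGT hε₀] with ε hε ν hν
  refine (measureReal_mono fun η hη => ?_).trans hRδ
  by_contra hηR
  obtain ⟨hprob, ν', hν', hle⟩ := hkl ε hε.1 hε.2 η (not_lt.1 hηR)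
  obtain ⟨⟨m, S, hS, hνη⟩, hmin⟩ := hν η
  have : IsProbabilityMeasure (ν η) := by rw [hνη]; infer_instance
  have hs := Real.sqrt_pos.2 hε.1
  have htv := tvDist_le_of_klDiv_le hs hD (by
    rw [Real.sq_sqrt hε.1.le]; exact (hmin ν' hν').trans hle)
  have hη' : (D + 2) * √ε ≤ tvDist (posterior G V₀ xt ε η) (ν η) := hη
  nlinarith
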